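/- **Definitions.** Ultrafilters on a set are ordered by reverse inclusion; a *cofinal subset* (filter base) of an ultrafilter $\mathcal U$ is a set $\mathcal C\subseteq\mathcal U$ such that every $X\in\mathcal U$ contains some $Y\in\mathcal C$. A map $f:\mathcal U\to\mathcal V$ between ultrafilters is *monotone* if $Y\subseteq X$ implies $f(Y)\subseteq f(X)$, and *cofinal* if the image of every cofinal subset of $\mathcal U$ is a cofinal subset of $\mathcal V$. We write $\mathcal V\le_T\mathcal U$ if there is a cofinal map $\mathcal U\to\mathcal V$. A *p-point* is a nonprincipal ultrafilter $\mathcal U$ on $\omega$ such that for each decreasing sequence $X_0\supseteq X_1\supseteq\cdots$ of members of $\mathcal U$ there is $Y\in\mathcal U$ with $Y\setminus X_n$ finite for all $n$. For an ultrafilter $\mathcal U$ on $\omega$ and ultrafilters $\mathcal V_n$ on sets $S_n$ ($n<\omega$), the *Fubini product* $\lim_{n\to\mathcal U}\mathcal V_n$ is the ultrafilter of all $A\subseteq\bigsqcup_n S_n$ with $\{n:\{j\in S_n:(n,j)\in A\}\in\mathcal V_n\}\in\mathcal U$. The *Fubini iterates of p-points* form the smallest class of ultrafilters that contains all p-points,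 contains $\lim_{n\to\mathcal U}\mathcal V_n$ whenever $\mathcal U$ is a p-point and all $\mathcal V_n$ are in the class, and is closed under bijections of base sets. For $X\subseteq\omega$ and $n<\omega$, $X\restriction n\in 2^n$ is the characteristic function of $X\cap n$ on $n=\{0,\dots,n-1\}$. For $s,t\in2^{<\omega}$, possibly of different lengths, $s\subseteq t$ means $\{i:s(i)=1\}\subseteq\{i:t(i)=1\}$; in unions, $s$ is identified with $\{i:s(i)=1\}$. **Theorem.** Let $\mathcal U$ be any Fubini iterate of p-points and let $\mathcal V$ be an ultrafilter on $\omega$ with $\mathcal V\le_T\mathcal U$. Then $\mathcal V$ has finitely generated Tukey reductions, that is, for every ultrafilter $\mathcal W$ on $\omega$ and every monotone cofinal map $f:\mathcal V\to\mathcal W$: 1. If $\mathcal V$ is nonprincipal, there are a cofinal subset $\mathcal D\subseteq\mathcal V$, a strictly increasing sequence $(k_m)_{m<\omega}$ of natural numbers, and a function $\hat f:D\to2^{<\omega}$, where $D=\{X\restriction k_m:X\in\mathcal D,\ m<\omega\}$, such that (a) $\hat f$ is level preserving: if $s\in D$ has length $k_m$, then $\hat f(s)$ has length $m$; (b) $\hat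 f$ is monotone: $s\subseteq t$ implies $\hat f(s)\subseteq\hat f(t)$ for all $s,t\in D$; (c) $\hat f$ generates $f$ on $\mathcal D$: $f(X)=\bigcup_{m<\omega}\hat f(X\restriction k_m)$ for each $X\in\mathcal D$. 2. There are a cofinal subset $\mathcal C\subseteq\mathcal V$ and a function $\hat f:[\omega]^{<\omega}\to[\omega]^{<\omega}$ such that $s\subseteq t$ implies $\hat f(s)\subseteq\hat f(t)$ for all finite $s,t\subseteq\omega$, and $f(X)=\bigcup_{k<\omega}\hat f(X\cap k)$ for each $X\in\mathcal C$. -/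

import Mathlib

namespace FinGenTukey

/-- An ultrafilter is nonprincipal if it contains no singleton. -/
def IsNonprincipal {α : Type} (U : Ultrafilter α) : Prop :=
  ∀ a : α, ({a} : Set α) ∉ U

/-- A p-point: a nonprincipal ultrafilter on `ω` in which every decreasing sequence of members
has a pseudo-intersection that is again a member. -/
def IsPPoint (U : Ultrafilter ℕ) : Prop :=
  IsNonprincipal U ∧
    ∀ X : ℕ → Set ℕ, (∀ n, X n ∈ U) → Antitone X →
      ∃ Y : Set ℕ, Y ∈ U ∧ ∀ n, (Y \ X n).Finite

/-- The Fubini product `lim_{n → U} V n`, on the disjoint union of the base sets of the `V n`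
(see `mem_fubiniLim`). -/
def fubiniLim (U : Ultrafilter ℕ) {β : ℕ → Type} (V : ∀ n, Ultrafilter (β n)) :
    Ultrafilter (Σ n, β n) :=
  U.bind fun n => (V n).map (Sigma.mk n)

theorem mem_fubiniLim (U : Ultrafilter ℕ) {β : ℕ → Type} (V : ∀ n, Ultrafilter (β n))
    (A : Set (Σ n, β n)) :
    A ∈ fubiniLim U V ↔ {n | {j : β n | (⟨n, j⟩ : Σ n, β n) ∈ A} ∈ V n} ∈ U :=
  Iff.rfl

/-- Fubini iterates of p-points: the smallest class of ultrafilters that contains all p-points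
and is closed under Fubini products of countably many of its members over a p-point, where
ultrafilters may be transported along bijections of their base sets. -/
inductive IsFubiniIterate : {α : Type} → Ultrafilter α → Prop
  | ppoint {U : Ultrafilter ℕ} (hU : IsPPoint U) : IsFubiniIterate U
  | lim {U : Ultrafilter ℕ} (hU : IsPPoint U) {β : ℕ → Type} {V : ∀ n, Ultrafilter (β n)}
      (hV : ∀ n, IsFubiniIterate (V n)) : IsFubiniIterate (fubiniLim U V)
  | iso {α β : Type} (e : α ≃ β) {U : Ultrafilter α} (hU : IsFubiniIterate U) :
      IsFubiniIterate (U.map e)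

/-- `C` is a cofinal subset (that is, a filter base) of `U`, with respect to reverse inclusion. -/
def IsCofinalIn {α : Type} (C : Set (Set α)) (U : Ultrafilter α) : Prop :=
  (∀ X ∈ C, X ∈ U) ∧ ∀ X ∈ U, ∃ Y ∈ C, Y ⊆ X

/-- `f` restricts to a cofinal map `U → V`: it maps members of `U` to members of `V` and each
filter base of `U` to a filter base of `V`. Its values outside `U` are irrelevant. -/
def IsCofinalMap {α β : Type} (U : Ultrafilter α) (V : Ultrafilter β)
    (f : Set α → Set β) : Prop :=
  (∀ X ∈ U, f X ∈ V) ∧ ∀ C : Set (Set α), IsCofinalIn C U → IsCofinalIn (f '' C) V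

/-- `f` is monotone on `U`. -/
def IsMonotoneOn {α β : Type} (U : Ultrafilter α) (f : Set α → Set β) : Prop :=
  ∀ X ∈ U, ∀ Y ∈ U, Y ⊆ X → f Y ⊆ f X

/-- `V ≤_T U`. -/
def TukeyReducible {α β : Type} (V : Ultrafilter β) (U : Ultrafilter α) : Prop :=
  ∃ f : Set α → Set β, IsCofinalMap U V f

/-- The set `2^{<ω}` of finite sequences `s : n → 2`. -/
structure BinSeq where
  length : ℕ
  val : Fin length → Bool

/-- The finite subset of `ω` of which `s` is a characteristic function. -/
def BinSeq.ones (s : BinSeq) : Set ℕ :=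
  {i | ∃ h : i < s.length, s.val ⟨i, h⟩ = true}

open Classical in
/-- `X ↾ n`: the characteristic function of `X ∩ n` with domain `n = {0, …, n - 1}`. -/
noncomputable def restrict (X : Set ℕ) (n : ℕ) : BinSeq :=
  ⟨n, fun i => decide ((i : ℕ) ∈ X)⟩

/-- The set `{X ↾ k m : X ∈ 𝒟, m < ω}`. -/
def restrictions (𝒟 : Set (Set ℕ)) (k : ℕ → ℕ) : Set BinSeq :=
  {s | ∃ X ∈ 𝒟, ∃ m : ℕ, s = restrict X (k m)}

/-- `V` has finitely generated Tukey reductions, with level preserving generating maps.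
Only the values of `fhat` on `restrictions 𝒟 k` matter. As usual `s ⊆ t` for finite
`0`-`1`-sequences, possibly of different lengths, is inclusion of the sets they represent. -/
def HasLevelFinitelyGeneratedTukeyReductions (V : Ultrafilter ℕ) : Prop :=
  ∀ (W : Ultrafilter ℕ) (f : Set ℕ → Set ℕ), IsMonotoneOn V f → IsCofinalMap V W f →
    ∃ (𝒟 : Set (Set ℕ)) (k : ℕ → ℕ) (fhat : BinSeq → BinSeq),
      IsCofinalIn 𝒟 V ∧ StrictMono k ∧
      (∀ s ∈ restrictions 𝒟 k, ∀ m : ℕ, s.length = k m → (fhat s).length = m) ∧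
      (∀ s ∈ restrictions 𝒟 k, ∀ t ∈ restrictions 𝒟 k,
        s.ones ⊆ t.ones → (fhat s).ones ⊆ (fhat t).ones) ∧
      ∀ X ∈ 𝒟, f X = ⋃ m : ℕ, (fhat (restrict X (k m))).ones

open Classical in
/-- `V` has finitely generated Tukey reductions, with generating maps
`[ω]^{<ω} → [ω]^{<ω}`. -/
def HasFinitelyGeneratedTukeyReductions (V : Ultrafilter ℕ) : Prop :=
  ∀ (W : Ultrafilter ℕ) (f : Set ℕ → Set ℕ), IsMonotoneOn V f → IsCofinalMap V W f →
    ∃ (𝒞 : Set (Set ℕ)) (fhat : Finset ℕ → Finset ℕ),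
      IsCofinalIn 𝒞 V ∧
      (∀ s t : Finset ℕ, s ⊆ t → fhat s ⊆ fhat t) ∧
      ∀ X ∈ 𝒞, f X = ⋃ k : ℕ, (fhat {i ∈ Finset.range k | i ∈ X} : Set ℕ)

end FinGenTukey

namespace FinGenTukey

/-! The key is `IsFinitelyDominated`. Applied to the families of X with n ∉ f X, it gives a base C
and, for each n, finitely many Z with n ∉ f Z such that each X ∈ C with n ∉ f X lies in some Z. If n
∈ f X, monotonicity makes X escape every Z; one escaping point per Z gives a finite s ⊆ X that
forces n ∈ f Y for all Y ∈ C containing s. Finite domination descends along Tukey reductions, and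
Fubini iterates have it by way of `HasFiniteClassification`, which is preserved in the induction. -/

/-- `U` has a base `C` and finite partitions of `C`, one for each `j < ω`, such that whenever
finitely many members of `C` are chosen at each stage `j`, for some `T ∈ U` and infinitely
many `j`, all elements of `C` below `T` lie below all sets of their class chosen at stage `j`. -/
def HasFiniteClassification {α : Type} (U : Ultrafilter α) : Prop :=
  ∃ (C : Set (Set α)) (cl : ℕ → Set α → ℕ), IsCofinalIn C U ∧ (∀ j, (cl j '' C).Finite) ∧
    ∀ R : ℕ → Set (Set α), (∀ j, (R j).Finite) → (∀ j, R j ⊆ C) →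
      ∀ J : Set ℕ, J.Infinite → ∃ J' ⊆ J, J'.Infinite ∧ ∃ T ∈ U,
        ∀ X ∈ C, X ⊆ T → ∀ j ∈ J', ∀ Z ∈ R j, cl j Z = cl j X → X ⊆ Z

/-- For any countably many families of members of `U`, each closed under passing to subsets in
`U`, there is a base of `U` on which each family is covered by finitely many of its members. -/
def IsFinitelyDominated {α : Type} (U : Ultrafilter α) : Prop :=
  ∀ I : ℕ → Set (Set α), (∀ i, ∀ X ∈ U, ∀ Y ∈ U, Y ⊆ X → X ∈ I i → Y ∈ I i) →
    ∃ C : Set (Set α), IsCofinalIn C U ∧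
      ∀ i, ∃ M : Set (Set α), M.Finite ∧ (∀ Z ∈ M, Z ∈ U ∧ Z ∈ I i) ∧
        ∀ X ∈ C, X ∈ I i → ∃ Z ∈ M, X ⊆ Z

/-! ### Finite classifications for Fubini iterates of p-points. -/

/-- A pseudo-intersection `Y` is eventually inside each `A j`. As the ultrafilter omits either the
even or the odd blocks of an interval partition, `T` can have a gap around each `j ∈ J'` reaching to
where `Y` has settled in `A j`. -/
theorem IsPPoint.exists_gaps {U : Ultrafilter ℕ} (hU : IsPPoint U) (A : ℕ → Set ℕ)
    (hA : ∀ j, A j ∈ U) (J : ℕ → Set ℕ) (hJ : ∀ n, (J n).Infinite) (hanti : Antitone J) :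
    ∃ J' ⊆ J 0, J'.Infinite ∧ ∃ T ∈ U,
      ∀ j ∈ J', ∀ x ∈ T, (x < j → j ∈ J x) ∧ (j ≤ x → x ∈ A j) := by
  obtain ⟨Y, hY, hYA⟩ := hU.2 (fun n => ⋂ j ∈ Finset.range (n + 1), A j)
    (fun n => (Filter.biInter_finset_mem _).2 fun j _ => hA j)
    (fun m n h => Set.biInter_subset_biInter_left fun j hj => by
      simp only [Finset.coe_range, Set.mem_Iio] at hj ⊢
      omega)
  have step : ∀ k : ℕ, ∃ j k' : ℕ, k < j ∧ j < k' ∧ j ∈ J k ∧ ∀ y ∈ Y, k' ≤ y → y ∈ A j := by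
    intro k
    obtain ⟨j, hj, hkj⟩ := (hJ k).exists_gt k
    obtain ⟨b, hb⟩ := (hYA j).bddAbove
    refine ⟨j, j + b + 1, hkj, by omega, hj, fun y hy hby => ?_⟩
    by_contra hyA
    have : y ≤ b := hb ⟨hy, fun h => hyA (Set.mem_iInter₂.1 h j (by simp))⟩
    omega
  choose j nxt hkj hjn hjJ hjA using step
  let k : ℕ → ℕ := fun i => nxt^[i] 0
  have hk1 : ∀ i, k (i + 1) = nxt (k i) := fun i => Function.iterate_succ_apply' _ _ _
  have hk : StrictMono k := strictMono_nat_of_lt_succ fun i => by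
    rw [hk1]; exact (hkj _).trans (hjn _)
  -- A set that avoids the intervals with index in `P` works with `J' = {j (k i) : i ∈ P}`.
  have key : ∀ P : Set ℕ, P.Infinite → ∀ E ∈ U,
      (∀ x ∈ E, ∀ i ∈ P, ¬ (k i ≤ x ∧ x < k (i + 1))) →
      ∃ J' ⊆ J 0, J'.Infinite ∧ ∃ T ∈ U,
        ∀ j ∈ J', ∀ x ∈ T, (x < j → j ∈ J x) ∧ (j ≤ x → x ∈ A j) := by
    intro P hP E hE havoid
    have hjk : StrictMono fun i => j (k i) := strictMono_nat_of_lt_succ fun i =>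
      (hjn _).trans (by rw [← hk1]; exact hkj _)
    refine ⟨(fun i => j (k i)) '' P, ?_, hP.image hjk.injective.injOn, Y ∩ E,
      Filter.inter_mem hY hE, ?_⟩
    · rintro _ ⟨i, -, rfl⟩
      exact hanti (Nat.zero_le _) (hjJ _)
    · rintro _ ⟨i, hi, rfl⟩ x ⟨hxY, hxE⟩
      have hx := havoid x hxE i hi
      have h1 := hkj (k i)
      have h2 := hjn (k i)
      rw [hk1] at hx
      refine ⟨fun h => hanti ?_ (hjJ (k i)), fun h => hjA (k i) x hxY ?_⟩ <;>
        · by_contra hc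
          exact hx (by dsimp only at h; omega)
  by_cases hE : (⋃ i, Set.Ico (k (2 * i)) (k (2 * i + 1))) ∈ U
  · refine key (Set.range fun i => 2 * i + 1)
      (Set.infinite_range_of_injective fun a b h => by simpa using h) _ hE ?_
    rintro x hx _ ⟨i, rfl⟩ ⟨h1, h2⟩
    obtain ⟨l, hl1, hl2⟩ := Set.mem_iUnion.1 hx
    have h3 := hk.lt_iff_lt.1 (h1.trans_lt hl2)
    have h4 := hk.lt_iff_lt.1 (hl1.trans_lt h2)
    dsimp only at h3 h4
    omega
  · refine key (Set.range fun i => 2 * i)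
      (Set.infinite_range_of_injective fun a b h => by simpa using h) _
      (Ultrafilter.compl_mem_iff_notMem.2 hE) ?_
    rintro x hx _ ⟨i, rfl⟩ h
    exact hx (Set.mem_iUnion.2 ⟨i, h⟩)

-- The class of X at j is its trace X ∩ j. Equal traces handle points below j; from j on, the gaps
-- put T inside `⋂₀ R j`.
open Classical in
theorem IsPPoint.hasFiniteClassification {U : Ultrafilter ℕ} (hU : IsPPoint U) :
    HasFiniteClassification U := by
  refine ⟨{X | X ∈ U}, fun j X => Encodable.encode {i ∈ Finset.range j | i ∈ X},
    ⟨fun X h => h, fun X h => ⟨X, h, subset_rfl⟩⟩, fun j => ?_, fun R hR hRU J hJ => ?_⟩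
  · refine ((Finset.range j).powerset.finite_toSet.image Encodable.encode).subset ?_
    rintro _ ⟨X, -, rfl⟩
    exact ⟨_, Finset.mem_coe.2 (Finset.mem_powerset.2 (Finset.filter_subset _ _)), rfl⟩
  · obtain ⟨J', hJ', hinf, T, hT, h⟩ := hU.exists_gaps (fun j => ⋂₀ R j)
      (fun j => (Filter.sInter_mem (hR j)).2 fun Z hZ => hRU j hZ) (fun _ => J) (fun _ => hJ)
      (fun _ _ _ => subset_rfl)
    refine ⟨J', hJ', hinf, T, hT, fun X _ hXT j hj Z hZ hcl x hx => ?_⟩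
    rcases lt_or_ge x j with hxj | hxj
    · have := Finset.ext_iff.1 (Encodable.encode_injective hcl) x
      simp only [Finset.mem_filter, Finset.mem_range, hxj, true_and] at this
      exact this.2 hx
    · exact (h j hj x (hXT hx)).2 hxj Z hZ

/-- The fibre of `X` over `n`. -/
abbrev fiber {β : ℕ → Type} (X : Set (Σ n, β n)) (n : ℕ) : Set (β n) := Sigma.mk n ⁻¹' X

-- Classes at j record the classes of the fibres n < j. `J` is thinned fibre by fibre and
-- `exists_gaps` diagonalizes. For n ≥ j it makes the fibres of all Z ∈ R j large, so `T' n` can be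
-- shrunk into them.
open Classical in
theorem hasFiniteClassification_fubiniLim {U : Ultrafilter ℕ} (hU : IsPPoint U) {β : ℕ → Type}
    {V : ∀ n, Ultrafilter (β n)} (hV : ∀ n, HasFiniteClassification (V n)) :
    HasFiniteClassification (fubiniLim U V) := by
  choose C cl hC hfin hR using hV
  refine ⟨{X | X ∈ fubiniLim U V ∧ ∀ n, fiber X n = ∅ ∨ fiber X n ∈ C n},
    fun j X => Encodable.encode fun n : Fin j =>
      -- The value 0 is reserved for empty fibres, so a nonempty fibre never shares a class with an
      -- empty one.
      if fiber X n = ∅ then 0 else cl n j (fiber X n) + 1,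
    ⟨fun X h => h.1, fun X hX => ?_⟩, fun j => ?_, fun R hRfin hRC J hJ => ?_⟩
  · have : ∀ n, ∃ Y : Set (β n), Y ⊆ fiber X n ∧ (Y = ∅ ∨ Y ∈ C n) ∧
        (fiber X n ∈ V n → Y ∈ V n) := by
      intro n
      by_cases h : fiber X n ∈ V n
      · obtain ⟨Y, hY, hYX⟩ := (hC n).2 _ h
        exact ⟨Y, hYX, Or.inr hY, fun _ => (hC n).1 Y hY⟩
      · exact ⟨∅, Set.empty_subset _, Or.inl rfl, fun h' => absurd h' h⟩
    choose Y hYX hYC hYV using this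
    refine ⟨{p | p.2 ∈ Y p.1}, ⟨?_, hYC⟩, fun p hp => hYX p.1 hp⟩
    rw [mem_fubiniLim] at hX ⊢
    exact Filter.mem_of_superset hX fun n hn => hYV n hn
  · refine ((Set.Finite.pi' fun n : Fin j =>
      ((hfin n j).image (· + 1)).insert 0).image Encodable.encode).subset ?_
    rintro _ ⟨X, hX, rfl⟩
    refine ⟨_, fun n => ?_, rfl⟩
    split_ifs with h
    · exact Set.mem_insert _ _
    · exact Set.mem_insert_of_mem _ ⟨_, ⟨_, (hX.2 n).resolve_left h, rfl⟩, rfl⟩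
  · have step : ∀ (n : ℕ) (J : Set ℕ), J.Infinite → ∃ J' ⊆ J, J'.Infinite ∧ ∃ T ∈ V n,
        ∀ X ∈ C n, X ⊆ T → ∀ j ∈ J', ∀ Z ∈ R j, fiber Z n ≠ ∅ →
          cl n j (fiber Z n) = cl n j X → X ⊆ fiber Z n := by
      intro n J hJ
      obtain ⟨J', h1, h2, T, hT, h⟩ := hR n
        (fun j => (fun Z => fiber Z n) '' {Z ∈ R j | fiber Z n ≠ ∅})
        (fun j => ((hRfin j).subset (Set.sep_subset _ _)).image _)
        (fun j => by
          rintro _ ⟨Z, ⟨hZ, hne⟩, rfl⟩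
          exact ((hRC j hZ).2 n).resolve_left hne) J hJ
      exact ⟨J', h1, h2, T, hT, fun X hX hXT j hj Z hZ hne hcl =>
        h X hX hXT j hj _ ⟨Z, ⟨hZ, hne⟩, rfl⟩ hcl⟩
    choose nxt hsub hinf T hT hTR using step
    let J₁ : ℕ → {J : Set ℕ // J.Infinite} := fun n =>
      Nat.rec ⟨J, hJ⟩ (fun n J => ⟨nxt n J.1 J.2, hinf n J.1 J.2⟩) n
    have hJ₁ : Antitone fun n => (J₁ n).1 := antitone_nat_of_succ_le fun n => hsub n _ _
    obtain ⟨J', hJ', hJ'inf, S, hS, h⟩ := hU.exists_gaps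
      (fun j => {n | ∀ Z ∈ R j, fiber Z n ∈ V n})
      (fun j => by
        have : {n | ∀ Z ∈ R j, fiber Z n ∈ V n} = ⋂ Z ∈ R j, {n | fiber Z n ∈ V n} := by
          ext; simp
        rw [this]
        exact (Filter.biInter_mem (hRfin j)).2 fun Z hZ => (hRC j hZ).1)
      -- The thinning for fibre n leads from `J₁ n` to `J₁ (n + 1)`.
      (fun n => (J₁ (n + 1)).1) (fun n => (J₁ (n + 1)).2) (fun m n hmn => hJ₁ (Nat.succ_le_succ hmn))
    let T' : ∀ n, Set (β n) := fun n => T n _ (J₁ n).2 ∩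
      ⋂ j ∈ Finset.range (n + 1), ⋂ Z ∈ {Z ∈ R j | fiber Z n ∈ V n}, fiber Z n
    have hT' : ∀ n, T' n ∈ V n := fun n => Filter.inter_mem (hT n _ _) <|
      (Filter.biInter_finset_mem _).2 fun j _ =>
        (Filter.biInter_mem ((hRfin j).subset (Set.sep_subset _ _))).2 fun Z hZ => hZ.2
    refine ⟨J', hJ'.trans (hJ₁ (Nat.zero_le 1)), hJ'inf, {p | p.1 ∈ S ∧ p.2 ∈ T' p.1}, ?_, ?_⟩
    · rw [mem_fubiniLim]
      refine Filter.mem_of_superset hS fun n hn => ?_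
      exact Filter.mem_of_superset (hT' n) fun y hy => ⟨hn, hy⟩
    · rintro X ⟨-, hXC⟩ hXT j hj Z hZ hcl ⟨n, y⟩ hy
      obtain ⟨hnS, hyT⟩ := hXT hy
      have hXn : fiber X n ≠ ∅ := Set.Nonempty.ne_empty ⟨y, hy⟩
      rcases lt_or_ge n j with hnj | hnj
      · have hcl' := congrFun (Encodable.encode_injective hcl) ⟨n, hnj⟩
        simp only [if_neg hXn] at hcl'
        split_ifs at hcl' with hZn
        exact hTR n _ (J₁ n).2 _ ((hXC n).resolve_left hXn) (fun z hz => (hXT hz).2.1) j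
          ((h j hj n hnS).1 hnj) Z hZ hZn (Nat.succ_injective hcl') hy
      · have hZV : fiber Z n ∈ V n := (h j hj n hnS).2 hnj Z hZ
        have := Set.mem_iInter₂.1 hyT.2 j (by simp; omega)
        exact Set.mem_iInter₂.1 this Z ⟨hZ, hZV⟩

theorem HasFiniteClassification.map_equiv {α β : Type} (e : α ≃ β) {U : Ultrafilter α}
    (hU : HasFiniteClassification U) : HasFiniteClassification (U.map e) := by
  obtain ⟨C, cl, hC, hfin, hR⟩ := hU
  refine ⟨{X | e ⁻¹' X ∈ C}, fun j X => cl j (e ⁻¹' X), ⟨fun X hX => hC.1 _ hX, fun X hX => ?_⟩,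
    fun j => (hfin j).subset ?_, fun R hRfin hRC J hJ => ?_⟩
  · obtain ⟨Y, hY, hYX⟩ := hC.2 _ hX
    refine ⟨e '' Y, ?_, by rwa [Set.image_subset_iff]⟩
    rwa [Set.mem_ofPred_eq, Set.preimage_image_eq _ e.injective]
  · rintro _ ⟨X, hX, rfl⟩
    exact ⟨_, hX, rfl⟩
  · obtain ⟨J', hJ', hinf, T, hT, h⟩ := hR (fun j => (e ⁻¹' ·) '' R j)
      (fun j => (hRfin j).image _) (fun j => by rintro _ ⟨Z, hZ, rfl⟩; exact hRC j hZ) J hJ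
    refine ⟨J', hJ', hinf, e '' T, ?_, fun X hX hXT j hj Z hZ hcl => ?_⟩
    · rwa [Ultrafilter.mem_map, Set.preimage_image_eq _ e.injective]
    · have := h _ hX (by
        rw [← Set.preimage_image_eq T e.injective]; exact Set.preimage_mono hXT) j hj _
        ⟨Z, hZ, rfl⟩ hcl
      exact (Set.preimage_subset_preimage_iff (by simp [e.surjective.range_eq])).1 this

theorem IsFubiniIterate.hasFiniteClassification {α : Type} {U : Ultrafilter α}
    (hU : IsFubiniIterate U) : HasFiniteClassification U := by
  induction hU with
  | ppoint hU => exact hU.hasFiniteClassification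
  | lim hU _ ih => exact hasFiniteClassification_fubiniLim hU ih
  | iso e _ ih => exact ih.map_equiv e

/-! ### Finite domination and Tukey reductions. -/

/-- Stage j chooses a representative of each class met by `I i`, for all i ≤ j. For fixed i, a
single j > i in `J'` then suffices. -/
theorem HasFiniteClassification.isFinitelyDominated {α : Type} {U : Ultrafilter α}
    (hU : HasFiniteClassification U) : IsFinitelyDominated U := by
  classical
  obtain ⟨C, cl, hC, hfin, hR⟩ := hU
  intro I _
  have rep : ∀ i j c, ∃ Z : Set α, (∃ X ∈ C, X ∈ I i ∧ cl j X = c) →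
      Z ∈ C ∧ Z ∈ I i ∧ cl j Z = c := by
    intro i j c
    by_cases h : ∃ X ∈ C, X ∈ I i ∧ cl j X = c
    · exact h.imp fun Z hZ _ => hZ
    · exact ⟨∅, fun h' => absurd h' h⟩
  choose r hr using rep
  -- Restricting to `C` discards junk values of `r` at classes that `I i` does not meet.
  have hRfin : ∀ j, {Z ∈ (⋃ i ∈ Finset.range (j + 1), r i j '' (cl j '' C)) | Z ∈ C}.Finite :=
    fun j => ((Finset.range (j + 1)).finite_toSet.biUnion fun i _ => (hfin j).image _).subset
      (Set.sep_subset _ _)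
  obtain ⟨J', -, hinf, T, hT, h⟩ := hR _ hRfin (fun j Z hZ => hZ.2) Set.univ Set.infinite_univ
  refine ⟨{X ∈ C | X ⊆ T}, ⟨fun X hX => hC.1 X hX.1, fun X hX => ?_⟩, fun i => ?_⟩
  · obtain ⟨Y, hY, hYX⟩ := hC.2 _ (Filter.inter_mem hX hT)
    exact ⟨Y, ⟨hY, hYX.trans Set.inter_subset_right⟩, hYX.trans Set.inter_subset_left⟩
  · obtain ⟨j, hj, hij⟩ := hinf.exists_gt i
    refine ⟨_, (hRfin j).subset (Set.sep_subset _ (· ∈ I i)), fun Z hZ => ⟨hC.1 _ hZ.1.2, hZ.2⟩,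
      fun X hX hXI => ?_⟩
    obtain ⟨h1, h2, h3⟩ := hr i j (cl j X) ⟨X, hX.1, hXI, rfl⟩
    have hmem : r i j (cl j X) ∈
        {Z ∈ (⋃ i ∈ Finset.range (j + 1), r i j '' (cl j '' C)) | Z ∈ C} :=
      ⟨Set.mem_iUnion₂.2 ⟨i, by simp; omega, _, ⟨X, hX.1, rfl⟩, rfl⟩, h1⟩
    exact ⟨_, ⟨hmem, h2⟩, h X hX.1 hX.2 j hj _ hmem h3⟩

/-- Otherwise the X with `f X` not inside `Y` form a base whose image has nothing below `Y`. -/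
theorem IsCofinalMap.exists_forall_subset {α β : Type} {U : Ultrafilter α} {V : Ultrafilter β}
    {f : Set α → Set β} (hf : IsCofinalMap U V f) {Y : Set β} (hY : Y ∈ V) :
    ∃ X ∈ U, ∀ X' ∈ U, X' ⊆ X → f X' ⊆ Y := by
  by_contra! h
  obtain ⟨_, ⟨X, ⟨-, hX⟩, rfl⟩, hXY⟩ := (hf.2 {X | X ∈ U ∧ ¬ f X ⊆ Y} ⟨fun X hX => hX.1,
    fun X hX => by
      obtain ⟨X', h1, h2, h3⟩ := h X hX
      exact ⟨X', ⟨h1, h3⟩, h2⟩⟩).2 Y hY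
  exact hX hXY

theorem IsFinitelyDominated.of_tukeyReducible {α β : Type} {U : Ultrafilter α}
    {V : Ultrafilter β} (hU : IsFinitelyDominated U) (hVU : TukeyReducible V U) :
    IsFinitelyDominated V := by
  obtain ⟨f, hf⟩ := hVU
  -- The monotone envelope of `f`: it pulls closed families back to closed families and still has
  -- values below every member of `V`.
  let g : Set α → Set β := fun X => ⋃ X' ∈ {X' | X' ∈ U ∧ X' ⊆ X}, f X'
  have hgV : ∀ X ∈ U, g X ∈ V := fun X hX => Filter.mem_of_superset (hf.1 X hX)
    (Set.subset_biUnion_of_mem (u := f) (show X ∈ {X' | X' ∈ U ∧ X' ⊆ X} from ⟨hX, subset_rfl⟩))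
  have hg : Monotone g := fun X Y hXY =>
    Set.biUnion_subset_biUnion_left fun X' h => ⟨h.1, h.2.trans hXY⟩
  intro I hI
  obtain ⟨C, hC, h⟩ := hU (fun i => {X | g X ∈ I i}) fun i X hX Y hY hYX hXI =>
    hI i _ (hgV X hX) _ (hgV Y hY) (hg hYX) hXI
  refine ⟨g '' C, ⟨?_, fun Y hY => ?_⟩, fun i => ?_⟩
  · rintro _ ⟨X, hX, rfl⟩
    exact hgV X (hC.1 X hX)
  · obtain ⟨X, hX, hXY⟩ := hf.exists_forall_subset hY
    obtain ⟨X', hX', hsub⟩ := hC.2 X hX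
    exact ⟨g X', ⟨X', hX', rfl⟩, Set.iUnion₂_subset fun Z hZ => hXY Z hZ.1 (hZ.2.trans hsub)⟩
  · obtain ⟨M, hM, hMI, hcov⟩ := h i
    refine ⟨g '' M, hM.image g, ?_, ?_⟩
    · rintro _ ⟨Z, hZ, rfl⟩
      exact ⟨hgV Z (hMI Z hZ).1, (hMI Z hZ).2⟩
    · rintro _ ⟨X, hX, rfl⟩ hXI
      obtain ⟨Z, hZ, hXZ⟩ := hcov X hX hXI
      exact ⟨_, ⟨Z, hZ, rfl⟩, hg hXZ⟩

/-! ### Finite generation of monotone maps. -/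

/-- On some base, membership in the value of a monotone map is decided by a finite subset of the
argument. -/
theorem IsFinitelyDominated.exists_finite_generation {α : Type} {V : Ultrafilter α}
    (hV : IsFinitelyDominated V) {f : Set α → Set ℕ} (hf : IsMonotoneOn V f) :
    ∃ C : Set (Set α), IsCofinalIn C V ∧ ∀ X ∈ C, ∀ n ∈ f X,
      ∃ s : Set α, s.Finite ∧ s ⊆ X ∧ ∀ Y ∈ C, s ⊆ Y → n ∈ f Y := by
  obtain ⟨C, hC, h⟩ := hV (fun n => {X | n ∉ f X}) fun n X hX Y hY hYX hn hn' =>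
    hn (hf X hX Y hY hYX hn')
  refine ⟨C, hC, fun X hX n hn => ?_⟩
  obtain ⟨M, hM, hMI, hcov⟩ := h n
  have : ∀ Z ∈ M, ∃ a ∈ X, a ∉ Z := fun Z hZ => Set.not_subset.1 fun hXZ =>
    (hMI Z hZ).2 (hf Z (hMI Z hZ).1 X (hC.1 X hX) hXZ hn)
  choose a haX haZ using this
  have := hM.to_subtype
  refine ⟨Set.range fun Z : M => a Z Z.2, Set.finite_range _,
    Set.range_subset_iff.2 fun Z => haX _ _, fun Y hY hs => ?_⟩
  by_contra hnY
  obtain ⟨Z, hZ, hYZ⟩ := hcov Y hY hnY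
  exact haZ Z hZ (hYZ (hs ⟨⟨Z, hZ⟩, rfl⟩))

theorem IsNonprincipal.infinite_of_mem {α : Type} {U : Ultrafilter α} (hU : IsNonprincipal U)
    {X : Set α} (hX : X ∈ U) : X.Infinite := fun hfin => by
  obtain ⟨a, -, rfl⟩ := Ultrafilter.eq_pure_of_finite_mem hfin hX
  exact hU a (Ultrafilter.mem_pure.2 rfl)

/-- The numbers below the maximum of `s` that lie in `f Y` for all `Y ∈ C` containing `s`. -/
def generated (C : Set (Set ℕ)) (f : Set ℕ → Set ℕ) (s : Set ℕ) : Set ℕ :=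
  {n | (∃ x ∈ s, n ≤ x) ∧ ∀ Y ∈ C, s ⊆ Y → n ∈ f Y}

theorem generated_mono (C : Set (Set ℕ)) (f : Set ℕ → Set ℕ) : Monotone (generated C f) :=
  fun _ _ hst _ hn => ⟨hn.1.imp fun _ hx => ⟨hst hx.1, hx.2⟩, fun Y hY h => hn.2 Y hY (hst.trans h)⟩

theorem eq_iUnion_generated {C : Set (Set ℕ)} {f : Set ℕ → Set ℕ}
    (h : ∀ X ∈ C, ∀ n ∈ f X, ∃ s : Set ℕ, s.Finite ∧ s ⊆ X ∧ ∀ Y ∈ C, s ⊆ Y → n ∈ f Y)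
    {X : Set ℕ} (hX : X ∈ C) (hinf : X.Infinite) :
    f X = ⋃ m, generated C f {i | i < m ∧ i ∈ X} := by
  refine subset_antisymm (fun n hn => ?_)
    (Set.iUnion_subset fun m n hn => hn.2 X hX fun i hi => hi.2)
  obtain ⟨s, hs, hsX, hsf⟩ := h X hX n hn
  obtain ⟨b, hb⟩ := hs.bddAbove
  -- With x above n and s, the trace of X on x + 1 contains s and meets the bound n ≤ x in
  -- `generated`.
  obtain ⟨x, hx, hxn⟩ := hinf.exists_gt (n + b)
  refine Set.mem_iUnion.2 ⟨x + 1, ⟨x, ⟨by omega, hx⟩, by omega⟩, fun Y hY hsub => hsf Y hY ?_⟩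
  intro i hi
  have := hb hi
  exact hsub ⟨by omega, hsX hi⟩

theorem ones_restrict (X : Set ℕ) (m : ℕ) : (restrict X m).ones = {i | i < m ∧ i ∈ X} := by
  ext i
  simp [BinSeq.ones, restrict]

theorem IsFinitelyDominated.hasLevelFinitelyGeneratedTukeyReductions {V : Ultrafilter ℕ}
    (hV : IsFinitelyDominated V) (hnp : IsNonprincipal V) :
    HasLevelFinitelyGeneratedTukeyReductions V := by
  classical
  intro W f hf _
  obtain ⟨C, hC, hgen⟩ := hV.exists_finite_generation hf
  let fhat : BinSeq → BinSeq := fun s =>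
    ⟨s.length, fun n => decide ((n : ℕ) ∈ generated C f s.ones)⟩
  -- The bound in `generated` keeps its elements below the length of s, so truncation loses nothing
  -- and `k = id` works.
  have hones : ∀ s, (fhat s).ones = generated C f s.ones := by
    intro s
    ext n
    refine ⟨fun ⟨_, h⟩ => of_decide_eq_true h, fun h => ?_⟩
    obtain ⟨x, ⟨hx, -⟩, hnx⟩ := h.1
    exact ⟨hnx.trans_lt hx, decide_eq_true h⟩
  refine ⟨C, id, fhat, hC, strictMono_id, fun s _ m h => h, fun s _ t _ hst => ?_,
    fun X hX => ?_⟩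
  · rw [hones, hones]
    exact generated_mono C f hst
  · simp only [hones, ones_restrict, id]
    exact eq_iUnion_generated hgen hX (hnp.infinite_of_mem (hC.1 X hX))

theorem IsFinitelyDominated.hasFinitelyGeneratedTukeyReductions_of_isNonprincipal
    {V : Ultrafilter ℕ} (hV : IsFinitelyDominated V) (hnp : IsNonprincipal V) :
    HasFinitelyGeneratedTukeyReductions V := by
  classical
  intro W f hf _
  obtain ⟨C, hC, hgen⟩ := hV.exists_finite_generation hf
  let fhat : Finset ℕ → Finset ℕ := fun s =>
    {n ∈ Finset.range (s.sup id + 1) | n ∈ generated C f (s : Set ℕ)}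
  have hcoe : ∀ s, (fhat s : Set ℕ) = generated C f (s : Set ℕ) := by
    intro s
    ext n
    simp only [fhat, Finset.coe_filter, Finset.mem_range, Set.mem_ofPred_eq,
      and_iff_right_iff_imp]
    rintro ⟨⟨x, hx, hnx⟩, -⟩
    have : x ≤ s.sup id := Finset.le_sup (f := id) hx
    omega
  refine ⟨C, fhat, hC, fun s t hst => ?_, fun X hX => ?_⟩
  · rw [← Finset.coe_subset, hcoe, hcoe]
    exact generated_mono C f (Finset.coe_subset.2 hst)
  · rw [eq_iUnion_generated hgen hX (hnp.infinite_of_mem (hC.1 X hX))]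
    refine Set.iUnion_congr fun m => ?_
    rw [hcoe]
    congr 1
    ext i
    simp

/-- `f {a}` lies inside every member of `W`, so it is a singleton {b} and a constant map generates
it. -/
theorem hasFinitelyGeneratedTukeyReductions_of_singleton_mem {V : Ultrafilter ℕ} {a : ℕ}
    (ha : {a} ∈ V) : HasFinitelyGeneratedTukeyReductions V := by
  intro W f _ hcof
  have hbase : IsCofinalIn {{a}} V := by
    refine ⟨fun X hX => by rwa [Set.mem_singleton_iff.1 hX], fun X hX => ⟨{a}, rfl, ?_⟩⟩
    obtain ⟨b, rfl, hb⟩ := V.nonempty_of_mem (Filter.inter_mem ha hX)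
    exact Set.singleton_subset_iff.2 hb
  have hmin : ∀ Z ∈ W, f {a} ⊆ Z := fun Z hZ => by
    obtain ⟨_, ⟨X, rfl, rfl⟩, h⟩ := (hcof.2 _ hbase).2 Z hZ
    exact h
  obtain ⟨b, hb⟩ := W.nonempty_of_mem (hcof.1 _ ha)
  have hbW : {b} ∈ W := by
    by_contra h
    exact hmin _ (Ultrafilter.compl_mem_iff_notMem.2 h) hb rfl
  refine ⟨{{a}}, fun _ => {b}, hbase, fun _ _ _ => subset_rfl, ?_⟩
  rintro X rfl
  rw [subset_antisymm (hmin _ hbW) (Set.singleton_subset_iff.2 hb)]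
  simp

end FinGenTukey

theorem theorem6p3 {α : Type} (U : Ultrafilter α) (V : Ultrafilter ℕ)
    (hU : FinGenTukey.IsFubiniIterate U) (hVU : FinGenTukey.TukeyReducible V U) :
    (FinGenTukey.IsNonprincipal V → FinGenTukey.HasLevelFinitelyGeneratedTukeyReductions V) ∧
      FinGenTukey.HasFinitelyGeneratedTukeyReductions V := by
  have hV := hU.hasFiniteClassification.isFinitelyDominated.of_tukeyReducible hVU
  refine ⟨hV.hasLevelFinitelyGeneratedTukeyReductions, ?_⟩
  by_cases hnp : FinGenTukey.IsNonprincipal V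
  · exact hV.hasFinitelyGeneratedTukeyReductions_of_isNonprincipal hnp
  · simp only [FinGenTukey.IsNonprincipal, not_forall, not_not] at hnp
    obtain ⟨a, ha⟩ := hnp
    exact FinGenTukey.hasFinitelyGeneratedTukeyReductions_of_singleton_mem ha
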